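/- Let $N\ge 3$, let $\Omega\subset\mathbb{R}^N$ be a bounded domain (a nonempty, bounded, connected open set), and let $1<p\le 2^*-1$, where $2^*=\frac{2N}{N-2}$. For $f$ on $\Omega$, a function $u\in H_0^1(\Omega)$ (the closure of $C_c^\infty(\Omega)$ in $H^1(\Omega)$) is said to solve $-\Delta u=f$ in $\Omega$, $u=0$ on $\partial\Omega$, if $\int_\Omega\nabla u\cdot\nabla\varphi\,dx=\int_\Omega f\varphi\,dx$ for all $\varphi\in H_0^1(\Omega)$; and $(-\Delta)^{-1}u=v$ means that $v\in H_0^1(\Omega)$ solves $-\Delta v=u$ in $\Omega$, $v=0$ on $\partial\Omega$. The eigenvalue problems $-\Delta u=\lambda u$ and $-\Delta u=\lambda(-\Delta)^{-1}u$ in $\Omega$, $u=0$ on $\partial\Omega$ (with real $\lambda$ and $u\in H_0^1(\Omega)$, $u\ne 0$), have smallest eigenvalues $\lambda_1$ and $\lambda_1^*$ respectively, and $\lambda_1^*=\lambda_1^2$. Moreover, for every real $\gamma\ge\lambda_1^*$ the problem $$-\Delta u=\gamma(-\Delta)^{-1}u+|u|^{p-1}u\ \text{ in }\Omega,\qquad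 u=0\ \text{ on }\partial\Omega,$$ has no positive solution, i.e. no solution $u\in H_0^1(\Omega)$ with $u>0$ almost everywhere in $\Omega$. -/

import Mathlib

open MeasureTheory Filter Topology
open scoped ContDiff

/-- `φ ∈ C_c^∞(Ω)`. -/
def IsTestFunction {N : ℕ} (Ω : Set (EuclideanSpace ℝ (Fin N)))
    (φ : EuclideanSpace ℝ (Fin N) → ℝ) : Prop :=
  ContDiff ℝ ∞ φ ∧ HasCompactSupport φ ∧ tsupport φ ⊆ Ω

/-- The Sobolev space `H_0^1(Ω)`, the closure of `C_c^∞(Ω)` in `H^1(Ω)`. An element is given by a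
representative `toFun` of the function together with a representative `grad` of its weak gradient:
both lie in `L²(Ω)`, and some sequence of test functions converges to `toFun` in `L²(Ω)` while its
classical gradients converge to `grad` in `L²(Ω)` (which determines `grad` from `toFun` almost
everywhere in `Ω`). Values outside `Ω` are irrelevant. -/
structure H01 {N : ℕ} (Ω : Set (EuclideanSpace ℝ (Fin N))) where
  toFun : EuclideanSpace ℝ (Fin N) → ℝ
  grad : EuclideanSpace ℝ (Fin N) → EuclideanSpace ℝ (Fin N)
  memLp_toFun : MemLp toFun 2 (volume.restrict Ω)
  memLp_grad : MemLp grad 2 (volume.restrict Ω)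
  exists_approx : ∃ φ : ℕ → EuclideanSpace ℝ (Fin N) → ℝ,
    (∀ n, IsTestFunction Ω (φ n)) ∧
    Tendsto (fun n => eLpNorm (fun x => φ n x - toFun x) 2 (volume.restrict Ω)) atTop (𝓝 0) ∧
    Tendsto (fun n => eLpNorm (fun x => gradient (φ n) x - grad x) 2 (volume.restrict Ω))
      atTop (𝓝 0)

/-- `u ∈ H_0^1(Ω)` is the weak solution of `-Δu = f` in `Ω`, `u = 0` on `∂Ω`:
`∫_Ω ∇u·∇φ = ∫_Ω f φ` for every `φ ∈ H_0^1(Ω)`. -/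
def SolvesDirichlet {N : ℕ} {Ω : Set (EuclideanSpace ℝ (Fin N))} (u : H01 Ω)
    (f : EuclideanSpace ℝ (Fin N) → ℝ) : Prop :=
  ∀ φ : H01 Ω, ∫ x in Ω, inner ℝ (u.grad x) (φ.grad x) = ∫ x in Ω, f x * φ.toFun x

/-- `v = (-Δ)⁻¹ u`, i.e. `-Δv = u` in `Ω` and `v = 0` on `∂Ω`. -/
def IsInverseLaplacian {N : ℕ} {Ω : Set (EuclideanSpace ℝ (Fin N))} (u v : H01 Ω) : Prop :=
  SolvesDirichlet v u.toFun

/-- The eigenvalues of `-Δu = lam u` in `Ω`, `u = 0` on `∂Ω`. -/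
def laplacianEigenvalues {N : ℕ} (Ω : Set (EuclideanSpace ℝ (Fin N))) : Set ℝ :=
  {lam | ∃ u : H01 Ω, ¬ (u.toFun =ᵐ[volume.restrict Ω] 0) ∧
    SolvesDirichlet u (fun x => lam * u.toFun x)}

/-- The eigenvalues of `-Δu = lam (-Δ)⁻¹u` in `Ω`, `u = 0` on `∂Ω`. -/
def nonlocalEigenvalues {N : ℕ} (Ω : Set (EuclideanSpace ℝ (Fin N))) : Set ℝ :=
  {lam | ∃ u v : H01 Ω, ¬ (u.toFun =ᵐ[volume.restrict Ω] 0) ∧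
    IsInverseLaplacian u v ∧ SolvesDirichlet u (fun x => lam * v.toFun x)}

/-- `u ∈ H_0^1(Ω)` is a positive weak (energy) solution of
`-Δu = γ (-Δ)⁻¹u + |u|^{p-1}u` in `Ω`, `u = 0` on `∂Ω`. -/
def IsPositiveSolution {N : ℕ} {Ω : Set (EuclideanSpace ℝ (Fin N))} (p γ : ℝ) (u : H01 Ω) :
    Prop :=
  (∀ᵐ x ∂(volume.restrict Ω), 0 < u.toFun x) ∧
  ∃ v : H01 Ω, IsInverseLaplacian u v ∧
    SolvesDirichlet u (fun x => γ * v.toFun x + |u.toFun x| ^ (p - 1) * u.toFun x)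

/-! Write `lam` for the minimum of ‖∇w‖² / ‖w‖² over H_0^1(Ω). It is positive by Poincaré, and it is
attained at some nonzero e ≥ 0 satisfying -Δe = `lam` e. Testing an eigenfunction with itself shows
that no eigenvalue of -Δ lies below `lam`. With v = e / `lam` = (-Δ)⁻¹e, the same e solves the
nonlocal problem with eigenvalue `lam`². Conversely, if -Δv = u and -Δu = μv, then ‖u‖² = μ‖v‖²,
while `lam`‖v‖² ≤ ‖∇v‖² = (u, v) gives `lam`‖v‖ ≤ ‖u‖; hence μ ≥ `lam`²
(`sq_le_of_mem_nonlocalEigenvalues`).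

For nonexistence, test the equation of a positive solution u with e, and that of v = (-Δ)⁻¹u as
well: `lam`²(v, e) = γ(v, e) + ∫ u^p e. The last integral is positive and (v, e) = (u, e) / `lam` ≥
0, so γ ≥ `lam`² is impossible (`not_isPositiveSolution`). Nonnegativity of e suffices, so no
maximum principle is needed.

The main work is the existence of e. `exists_rayleigh_minimizer` runs the direct method in a product
of Hilbert spaces; its compactness input is Rellich's theorem `totallyBounded_testGraph`, derived
from translation estimates. The minimizing sequence consists of nonnegative test functions, so the
limit is nonnegative. -/

/-! ### Rayleigh quotients and compactness in abstract Hilbert spaces -/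

section Variational

variable {A B : Type*} [NormedAddCommGroup A] [InnerProductSpace ℝ A] [CompleteSpace A]
  [NormedAddCommGroup B] [InnerProductSpace ℝ B] [CompleteSpace B]

/-- Existence of minimizers of the Rayleigh quotient `‖w.2‖² / ‖w.1‖²` over a subspace `D`, as
limits of elements of a subset `S` over which the infimum can be approached. -/
theorem exists_rayleigh_minimizer (D : Submodule ℝ (A × B)) (S : Set (A × B)) (hSD : S ⊆ D)
    (hne : ∃ w ∈ D, w.1 ≠ 0)
    (hS : ∀ w ∈ D, ∀ δ > 0, ∃ s ∈ S, ‖s.2‖ ≤ ‖w.2‖ ∧ ‖s.1‖ ≤ ‖w.1‖ ∧ ‖w.1‖ - δ ≤ ‖s.1‖)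
    (hcomp : ∀ C : ℝ, TotallyBounded (Prod.fst '' {w : A × B | w ∈ D ∧ ‖w.2‖ ≤ C})) :
    ∃ lam : ℝ, (∀ w ∈ D, lam * ‖w.1‖ ^ 2 ≤ ‖w.2‖ ^ 2) ∧
      ∃ w ∈ closure S, ‖w.1‖ = 1 ∧ ‖w.2‖ ^ 2 = lam := by
  set R : Set ℝ := {r | ∃ w ∈ D, ‖w.1‖ = 1 ∧ r = ‖w.2‖ ^ 2} with hR
  have hRbdd : BddBelow R := ⟨0, by rintro _ ⟨w, -, -, rfl⟩; positivity⟩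
  have hnorm : ∀ w ∈ D, w.1 ≠ 0 → (‖w.2‖ / ‖w.1‖) ^ 2 ∈ R := by
    intro w hw h0
    refine ⟨‖w.1‖⁻¹ • w, D.smul_mem _ hw, ?_, ?_⟩
    · rw [Prod.smul_fst, norm_smul, norm_inv, norm_norm, inv_mul_cancel₀ (norm_ne_zero_iff.2 h0)]
    · rw [Prod.smul_snd, norm_smul, norm_inv, norm_norm]; ring
  have hRne : R.Nonempty := let ⟨w, hw, h0⟩ := hne; ⟨_, hnorm w hw h0⟩
  set lam := sInf R with hlam
  have hlow : ∀ w ∈ D, lam * ‖w.1‖ ^ 2 ≤ ‖w.2‖ ^ 2 := by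
    intro w hw
    by_cases h0 : w.1 = 0
    · simp [h0]
    · have h1 := csInf_le hRbdd (hnorm w hw h0)
      have h2 : 0 < ‖w.1‖ := norm_pos_iff.2 h0
      rw [div_pow, le_div_iff₀ (by positivity)] at h1
      exact h1
  refine ⟨lam, hlow, ?_⟩
  have hseq : ∀ n : ℕ, ∃ s ∈ S, ‖s.2‖ ^ 2 ≤ lam + 1 / ((n : ℝ) + 1) ∧ ‖s.1‖ ≤ 1 ∧
      1 - 1 / ((n : ℝ) + 1) ≤ ‖s.1‖ := by
    intro n
    have hn : (0 : ℝ) < 1 / ((n : ℝ) + 1) := by positivity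
    obtain ⟨r, ⟨w, hw, hw1, rfl⟩, hr⟩ := exists_lt_of_csInf_lt hRne (lt_add_of_pos_right lam hn)
    obtain ⟨s, hs, h1, h2, h3⟩ := hS w hw _ hn
    rw [hw1] at h2 h3
    exact ⟨s, hs, (pow_le_pow_left₀ (norm_nonneg _) h1 2).trans hr.le, h2, h3⟩
  choose s hsS hs2 hs1 hs1' using hseq
  have hbound : ∀ n, ‖(s n).2‖ ≤ Real.sqrt (lam + 1) := by
    intro n
    refine Real.le_sqrt_of_sq_le ((hs2 n).trans ?_)
    have : 1 / ((n : ℝ) + 1) ≤ 1 := by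
      rw [div_le_one (by positivity)]; linarith [Nat.cast_nonneg (α := ℝ) n]
    linarith
  set K := Prod.fst '' {w : A × B | w ∈ D ∧ ‖w.2‖ ≤ Real.sqrt (lam + 1)}
  have hK : IsCompact (closure K) :=
    (hcomp _).closure.isCompact_of_isClosed isClosed_closure
  obtain ⟨a, -, k, hk, hka⟩ := hK.tendsto_subseq (x := fun n => (s n).1)
    (fun n => subset_closure ⟨s n, ⟨hSD (hsS n), hbound n⟩, rfl⟩)
  have hinv : Tendsto (fun n => 1 / ((k n : ℝ) + 1)) atTop (𝓝 0) :=
    tendsto_one_div_add_atTop_nhds_zero_nat.comp hk.tendsto_atTop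
  have ha : ‖a‖ = 1 := by
    refine tendsto_nhds_unique hka.norm (tendsto_of_tendsto_of_tendsto_of_le_of_le
      (g := fun n => 1 - 1 / ((k n : ℝ) + 1)) (h := fun _ => 1) ?_ tendsto_const_nhds
      (fun n => hs1' _) (fun n => hs1 _))
    simpa using (tendsto_const_nhds (x := (1 : ℝ))).sub hinv
  -- The parallelogram law bounds ‖x - y‖² by 2‖x‖² + 2‖y‖² - `lam`‖x' + y'‖², where x', y' are the
  -- first components. Since these converge to a unit vector, the bound tends to 2`lam` + 2`lam` -
  -- 4`lam` = 0, so convergence of the second components is strong.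
  have hcau : CauchySeq (fun n => (s (k n)).2) := by
    rw [Metric.cauchySeq_iff']
    have hlim : Tendsto (fun q : ℕ × ℕ => 2 * (lam + 1 / ((k q.1 : ℝ) + 1)) +
        2 * (lam + 1 / ((k q.2 : ℝ) + 1)) - lam * ‖(s (k q.1)).1 + (s (k q.2)).1‖ ^ 2)
        (atTop ×ˢ atTop) (𝓝 0) := by
      have e1 := hinv.comp (tendsto_fst (f := (atTop : Filter ℕ)) (g := (atTop : Filter ℕ)))
      have e2 := hinv.comp (tendsto_snd (f := (atTop : Filter ℕ)) (g := (atTop : Filter ℕ)))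
      have e3 := hka.comp (tendsto_fst (f := (atTop : Filter ℕ)) (g := (atTop : Filter ℕ)))
      have e4 := hka.comp (tendsto_snd (f := (atTop : Filter ℕ)) (g := (atTop : Filter ℕ)))
      have := (((e1.const_add lam).const_mul 2).add ((e2.const_add lam).const_mul 2)).sub
        (((e3.add e4).norm.pow 2).const_mul lam)
      have haa : ‖a + a‖ = 2 := by rw [← two_smul ℝ a, norm_smul, ha]; norm_num
      rw [haa] at this
      rwa [show 2 * (lam + 0) + 2 * (lam + 0) - lam * 2 ^ 2 = 0 by ring] at this
    intro ε hε
    have hev := hlim.eventually (gt_mem_nhds (show (0 : ℝ) < ε ^ 2 by positivity))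
    rw [prod_atTop_atTop_eq, eventually_atTop] at hev
    obtain ⟨⟨n₁, n₂⟩, h⟩ := hev
    refine ⟨max n₁ n₂, fun n hn => ?_⟩
    have h1 := h (n, max n₁ n₂) ⟨(le_max_left _ _).trans hn, le_max_right _ _⟩
    have h2 := hlow _ (D.add_mem (hSD (hsS (k n))) (hSD (hsS (k (max n₁ n₂)))))
    have h3 := parallelogram_law_with_norm ℝ (s (k n)).2 (s (k (max n₁ n₂))).2
    have h4 := hs2 (k n)
    have h5 := hs2 (k (max n₁ n₂))
    simp only [Prod.fst_add, Prod.snd_add] at h1 h2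
    rw [dist_eq_norm]
    refine lt_of_pow_lt_pow_left₀ 2 hε.le ?_
    nlinarith
  obtain ⟨b, hb⟩ := cauchySeq_tendsto_of_complete hcau
  refine ⟨(a, b), mem_closure_of_tendsto (hka.prodMk_nhds hb)
    (Eventually.of_forall fun n => hsS _), ha, le_antisymm ?_ ?_⟩
  · refine le_of_tendsto_of_tendsto' (hb.norm.pow 2) ?_ (fun n => hs2 (k n))
    simpa using hinv.const_add lam
  · have := le_of_tendsto_of_tendsto' ((hka.norm.pow 2).const_mul lam) (hb.norm.pow 2)
      (fun n => hlow _ (hSD (hsS (k n))))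
    simpa [ha] using this

omit [CompleteSpace A] [CompleteSpace B] in
/-- The Euler–Lagrange equation of a minimizer of the Rayleigh quotient. -/
theorem inner_eq_of_rayleigh_minimizer {D : Submodule ℝ (A × B)} {lam : ℝ}
    (hlow : ∀ w ∈ D, lam * ‖w.1‖ ^ 2 ≤ ‖w.2‖ ^ 2) {w z : A × B} (hw : w ∈ D) (hz : z ∈ D)
    (hmin : ‖w.2‖ ^ 2 = lam * ‖w.1‖ ^ 2) :
    inner ℝ w.2 z.2 = lam * inner ℝ w.1 z.1 := by
  have key : ∀ t : ℝ, 0 ≤ 2 * t * (inner ℝ w.2 z.2 - lam * inner ℝ w.1 z.1) +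
      t ^ 2 * (‖z.2‖ ^ 2 - lam * ‖z.1‖ ^ 2) := by
    intro t
    have h := hlow _ (D.add_mem hw (D.smul_mem t hz))
    simp only [Prod.fst_add, Prod.snd_add, Prod.smul_fst, Prod.smul_snd, norm_add_sq_real,
      inner_smul_right, norm_smul, mul_pow, Real.norm_eq_abs, sq_abs] at h
    linarith
  set p := inner ℝ w.2 z.2 - lam * inner ℝ w.1 z.1
  set q := ‖z.2‖ ^ 2 - lam * ‖z.1‖ ^ 2
  have hq : 0 ≤ q := by simpa [q] using hlow z hz
  -- This is nearly the minimizer -p/q of the quadratic; the added 1 covers q = 0.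
  have h := key (-(p / (q + 1)))
  have hp : p = 0 := by
    have e : 2 * -(p / (q + 1)) * p + (-(p / (q + 1))) ^ 2 * q =
        -(p ^ 2 * (q + 2) / (q + 1) ^ 2) := by
      field_simp; ring
    rw [e] at h
    have : p ^ 2 * (q + 2) / (q + 1) ^ 2 ≤ 0 := by linarith
    by_contra hp
    have : 0 < p ^ 2 * (q + 2) / (q + 1) ^ 2 := by positivity
    linarith
  linarith [hp]

omit [CompleteSpace A] [CompleteSpace B] in
/-- If, up to a small multiple of `‖w.2‖²`, finitely many functionals control `‖w.1‖²` on `D`,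
then `D → A` is a compact map for the norm of the second component. -/
theorem totallyBounded_fst_image (D : Submodule ℝ (A × B)) {P : ℝ}
    (hP : ∀ w ∈ D, ‖w.1‖ ^ 2 ≤ P * ‖w.2‖ ^ 2)
    (hfin : ∀ η > 0, ∃ (t : Finset A) (c : ℝ), 0 ≤ c ∧
      ∀ w ∈ D, ‖w.1‖ ^ 2 ≤ η * ‖w.2‖ ^ 2 + c * ∑ a ∈ t, (inner ℝ a w.1) ^ 2) (C : ℝ) :
    TotallyBounded (Prod.fst '' {w : A × B | w ∈ D ∧ ‖w.2‖ ≤ C}) := by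
  set K := Prod.fst '' {w : A × B | w ∈ D ∧ ‖w.2‖ ≤ C} with hK
  refine Metric.totallyBounded_of_finite_discretization fun ε hε => ?_
  -- Differences of elements of the set have energy at most 4C², so this η keeps the energy term
  -- strictly below ε²/2; the added 1 gives strictness and covers C = 0.
  obtain ⟨t, c, hc, ht⟩ := hfin (ε ^ 2 / (2 * (4 * C ^ 2 + 1))) (by positivity)
  let T : A → (t → ℝ) := fun x a => inner ℝ (a : A) x
  have hTb : Bornology.IsBounded (T '' K) := by
    obtain ⟨M, hM⟩ : ∃ M, ∀ a ∈ t, ‖a‖ ≤ M := by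
      obtain ⟨M, hM⟩ := (t.image norm).bddAbove
      exact ⟨M, fun a ha => hM (by simpa using ⟨a, ha, rfl⟩)⟩
    refine isBounded_iff_forall_norm_le.2 ⟨|M| * Real.sqrt (|P| * C ^ 2), ?_⟩
    rintro _ ⟨_, ⟨w, ⟨hw, hwC⟩, rfl⟩, rfl⟩
    refine (pi_norm_le_iff_of_nonneg (by positivity)).2 fun a => ?_
    refine (norm_inner_le_norm _ _).trans (mul_le_mul ((hM _ a.2).trans (le_abs_self _)) ?_
      (norm_nonneg _) (abs_nonneg _))
    refine Real.le_sqrt_of_sq_le ((hP w hw).trans (mul_le_mul (le_abs_self _) ?_ (by positivity)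
      (abs_nonneg _)))
    gcongr
  -- Chosen so that two points sharing a δ-ball under `T`, hence with images at most 2δ apart,
  -- contribute at most c · card · (2δ)² ≤ ε²/2.
  set δ : ℝ := Real.sqrt (ε ^ 2 / (8 * (c + 1) * (t.card + 1))) with hδ
  have hδ2 : δ ^ 2 = ε ^ 2 / (8 * (c + 1) * (t.card + 1)) := Real.sq_sqrt (by positivity)
  have hδ0 : 0 < δ := Real.sqrt_pos.2 (by positivity)
  obtain ⟨r, hr⟩ := hTb.subset_closedBall 0
  obtain ⟨s, hs, hcov⟩ := Metric.totallyBounded_iff.1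
    ((isCompact_closedBall 0 r).totallyBounded.subset hr) δ hδ0
  have hx : ∀ x : K, ∃ y : s, T x ∈ Metric.ball (y : t → ℝ) δ := by
    intro x
    obtain ⟨y, hy, hxy⟩ := Set.mem_iUnion₂.1 (hcov ⟨x, x.2, rfl⟩)
    exact ⟨⟨y, hy⟩, hxy⟩
  choose F hF using hx
  refine ⟨s, hs.fintype, F, fun x y hxy => ?_⟩
  obtain ⟨_, w, ⟨hw, hwC⟩, rfl⟩ := x
  obtain ⟨_, w', ⟨hw', hwC'⟩, rfl⟩ := y
  have h1 := ht _ (D.sub_mem hw hw')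
  have hd : ‖T w.1 - T w'.1‖ ≤ 2 * δ := by
    have e1 := hF ⟨w.1, w, ⟨hw, hwC⟩, rfl⟩
    have e2 := hF ⟨w'.1, w', ⟨hw', hwC'⟩, rfl⟩
    rw [hxy] at e1
    rw [Metric.mem_ball] at e1 e2
    rw [← dist_eq_norm]
    linarith [dist_triangle_right (T w.1) (T w'.1)
      (F ⟨w'.1, w', ⟨hw', hwC'⟩, rfl⟩ : t → ℝ)]
  have h2 : ∑ a ∈ t, (inner ℝ a (w.1 - w'.1)) ^ 2 ≤ t.card * (2 * δ) ^ 2 := by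
    rw [← nsmul_eq_mul]
    refine Finset.sum_le_card_nsmul _ _ _ fun a ha => ?_
    have := (norm_le_pi_norm (T w.1 - T w'.1) ⟨a, ha⟩).trans hd
    rw [inner_sub_right, ← sq_abs]
    exact pow_le_pow_left₀ (abs_nonneg _) this 2
  have h3 : ‖w.2 - w'.2‖ ^ 2 ≤ 4 * C ^ 2 := by
    have : ‖w.2 - w'.2‖ ≤ 2 * C := (norm_sub_le _ _).trans (by linarith)
    calc _ ≤ (2 * C) ^ 2 := pow_le_pow_left₀ (norm_nonneg _) this 2
      _ = _ := by ring
  have h4 : ε ^ 2 / (2 * (4 * C ^ 2 + 1)) * ‖w.2 - w'.2‖ ^ 2 < ε ^ 2 / 2 := by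
    rw [div_mul_eq_mul_div, div_lt_div_iff₀ (by positivity) (by positivity)]
    nlinarith [sq_pos_of_pos hε]
  have h5 : c * (t.card * (2 * δ) ^ 2) ≤ ε ^ 2 / 2 := by
    rw [mul_pow, hδ2]
    have : c * (t.card * (2 ^ 2 * (ε ^ 2 / (8 * (c + 1) * (t.card + 1))))) =
        ε ^ 2 / 2 * ((c / (c + 1)) * (t.card / (t.card + 1))) := by field_simp; norm_num
    rw [this]
    refine mul_le_of_le_one_right (by positivity) (mul_le_one₀ ?_ (by positivity) ?_)
    · rw [div_le_one (by positivity)]; linarith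
    · rw [div_le_one (by positivity)]; linarith
  simp only [Prod.fst_sub, Prod.snd_sub] at h1
  rw [dist_eq_norm]
  refine lt_of_pow_lt_pow_left₀ 2 hε.le ?_
  have h6 := mul_le_mul_of_nonneg_left h2 hc
  linarith

end Variational

/-! ### Elementary inequalities for extended nonnegative reals -/

theorem lintegral_sq_le_measure_univ_mul {α : Type*} [MeasurableSpace α] {ν : Measure α}
    {g : α → ENNReal} (hg : AEMeasurable g ν) :
    (∫⁻ x, g x ∂ν) ^ 2 ≤ ν Set.univ * ∫⁻ x, g x ^ 2 ∂ν := by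
  have h := ENNReal.lintegral_mul_le_Lp_mul_Lq ν Real.HolderConjugate.two_two hg
    (aemeasurable_const (b := (1 : ENNReal)))
  simp only [Pi.mul_apply, mul_one, ENNReal.rpow_two, one_pow, lintegral_one] at h
  refine (pow_le_pow_left' h 2).trans_eq ?_
  rw [mul_pow, ← ENNReal.rpow_two, ← ENNReal.rpow_two, ← ENNReal.rpow_mul, ← ENNReal.rpow_mul]
  norm_num [mul_comm]

theorem ENNReal.add_sq_le_four_mul (a b : ENNReal) : (a + b) ^ 2 ≤ 4 * (a ^ 2 + b ^ 2) := by
  have h1 : a + b ≤ 2 * max a b := by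
    rw [two_mul]; exact add_le_add (le_max_left _ _) (le_max_right _ _)
  calc (a + b) ^ 2 ≤ (2 * max a b) ^ 2 := pow_le_pow_left' h1 2
    _ = 4 * max a b ^ 2 := by rw [mul_pow]; norm_num
    _ ≤ 4 * (a ^ 2 + b ^ 2) := by
      gcongr
      rcases le_total a b with h | h
      · rw [max_eq_right h]; exact le_add_self
      · rw [max_eq_left h]; exact le_self_add

/-! ### Translation estimates, Poincaré and control by finitely many averages -/

section Sobolev

variable {N : ℕ}

local notation "E" => EuclideanSpace ℝ (Fin N)

theorem norm_gradient_eq_norm_fderiv (φ : E → ℝ) (x : E) : ‖gradient φ x‖ = ‖fderiv ℝ φ x‖ := by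
  simp [gradient]

theorem enorm_gradient_eq_enorm_fderiv (φ : E → ℝ) (x : E) :
    ‖gradient φ x‖ₑ = ‖fderiv ℝ φ x‖ₑ := by
  rw [← ofReal_norm, ← ofReal_norm, norm_gradient_eq_norm_fderiv]

/-- Write the difference as the integral of the derivative along the segment from x to x + h, apply
Cauchy–Schwarz in t, then Tonelli and translation invariance in x. -/
theorem lintegral_enorm_translate_sub_sq_le {φ : E → ℝ} (hφ : ContDiff ℝ 1 φ) (h : E) :
    ∫⁻ x, ‖φ (x + h) - φ x‖ₑ ^ 2 ≤ ‖h‖ₑ ^ 2 * ∫⁻ x, ‖gradient φ x‖ₑ ^ 2 := by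
  have hcf : Continuous (fderiv ℝ φ) := hφ.continuous_fderiv one_ne_zero
  have hpt : ∀ x, ‖φ (x + h) - φ x‖ₑ ^ 2 ≤
      ‖h‖ₑ ^ 2 * ∫⁻ t in Set.Ioc (0 : ℝ) 1, ‖fderiv ℝ φ (x + t • h)‖ₑ ^ 2 := by
    intro x
    have hc : Continuous fun t : ℝ => fderiv ℝ φ (x + t • h) := by fun_prop
    have hd : ∀ t : ℝ, HasDerivAt (fun t : ℝ => φ (x + t • h)) (fderiv ℝ φ (x + t • h) h) t := by
      intro t
      have h1 : HasDerivAt (fun t : ℝ => x + t • h) h t := by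
        simpa using ((hasDerivAt_id t).smul_const h).const_add x
      exact ((hφ.differentiable one_ne_zero _).hasFDerivAt).comp_hasDerivAt t h1
    have h2 := intervalIntegral.integral_eq_sub_of_hasDerivAt (a := 0) (b := 1)
      (fun t _ => hd t) ((hc.clm_apply continuous_const).intervalIntegrable _ _)
    simp only [one_smul, zero_smul, add_zero] at h2
    rw [← h2, intervalIntegral.integral_of_le zero_le_one]
    have hmeas : AEMeasurable (fun t : ℝ => ‖fderiv ℝ φ (x + t • h)‖ₑ)
        (volume.restrict (Set.Ioc (0 : ℝ) 1)) := hc.enorm.aemeasurable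
    calc _ ≤ (∫⁻ t in Set.Ioc (0 : ℝ) 1, ‖h‖ₑ * ‖fderiv ℝ φ (x + t • h)‖ₑ) ^ 2 := by
          refine pow_le_pow_left' ((enorm_integral_le_lintegral_enorm _).trans
            (lintegral_mono fun t => ?_)) 2
          rw [mul_comm]
          exact ContinuousLinearMap.le_opENorm _ _
      _ = ‖h‖ₑ ^ 2 * (∫⁻ t in Set.Ioc (0 : ℝ) 1, ‖fderiv ℝ φ (x + t • h)‖ₑ) ^ 2 := by
          rw [lintegral_const_mul'' _ hmeas, mul_pow]
      _ ≤ _ := by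
          gcongr
          simpa using lintegral_sq_le_measure_univ_mul hmeas
  have hm : Measurable (Function.uncurry fun (x : E) (t : ℝ) =>
      ‖fderiv ℝ φ (x + t • h)‖ₑ ^ 2) := by
    have : Continuous (Function.uncurry fun (x : E) (t : ℝ) => fderiv ℝ φ (x + t • h)) := by
      simp only [Function.uncurry_def]; fun_prop
    exact (this.enorm.measurable).pow_const 2
  calc _ ≤ ∫⁻ x, ‖h‖ₑ ^ 2 * ∫⁻ t in Set.Ioc (0 : ℝ) 1, ‖fderiv ℝ φ (x + t • h)‖ₑ ^ 2 :=
        lintegral_mono hpt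
    _ = ‖h‖ₑ ^ 2 * ∫⁻ x, ∫⁻ t in Set.Ioc (0 : ℝ) 1, ‖fderiv ℝ φ (x + t • h)‖ₑ ^ 2 :=
        lintegral_const_mul _ hm.lintegral_prod_right
    _ = ‖h‖ₑ ^ 2 * ∫⁻ t in Set.Ioc (0 : ℝ) 1, ∫⁻ x, ‖fderiv ℝ φ (x + t • h)‖ₑ ^ 2 := by
        rw [lintegral_lintegral_swap hm.aemeasurable]
    _ = _ := by
        congr 1
        have : ∀ t : ℝ, ∫⁻ x, ‖fderiv ℝ φ (x + t • h)‖ₑ ^ 2 = ∫⁻ x, ‖gradient φ x‖ₑ ^ 2 := by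
          intro t
          simp_rw [enorm_gradient_eq_enorm_fderiv]
          exact lintegral_add_right_eq_self (fun x => ‖fderiv ℝ φ x‖ₑ ^ 2) (t • h)
        simp [this]

/-- The Poincaré inequality for `C¹` functions vanishing outside of a ball. -/
theorem lintegral_enorm_sq_le_of_support_subset_ball (hN : 0 < N) {φ : E → ℝ}
    (hφ : ContDiff ℝ 1 φ) {R : ℝ} (hR : 0 < R)
    (hsupp : Function.support φ ⊆ Metric.ball 0 R) :
    ∫⁻ x, ‖φ x‖ₑ ^ 2 ≤ ENNReal.ofReal (2 * R) ^ 2 * ∫⁻ x, ‖gradient φ x‖ₑ ^ 2 := by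
  have : Nonempty (Fin N) := ⟨⟨0, hN⟩⟩
  -- A shift by 2R moves the ball off itself, so φ(x + h) = 0 wherever φ(x) ≠ 0, and the translation
  -- estimate becomes Poincaré.
  obtain ⟨h, hh⟩ := exists_norm_eq E (show 0 ≤ 2 * R by positivity)
  refine le_trans (lintegral_mono fun x => ?_) ((lintegral_enorm_translate_sub_sq_le hφ h).trans_eq
    (by rw [← ofReal_norm, hh]))
  by_cases hx : φ x = 0
  · simp [hx]
  have hx' : φ (x + h) = 0 := by
    by_contra hne
    have h1 := mem_ball_zero_iff.1 (hsupp hx)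
    have h2 := mem_ball_zero_iff.1 (hsupp hne)
    have h3 : ‖h‖ ≤ ‖x + h‖ + ‖x‖ := by simpa using norm_sub_le (x + h) x
    linarith
  simp [hx']

/-- The left side is at most the average of |f(y) - f(x)|² by Cauchy–Schwarz, and y - x has length
below 2ε for y in the ball. The resulting bound no longer involves z, so it can be integrated over x
even though z varies with x. -/
theorem enorm_sub_average_sq_le {f : E → ℝ} (hf : Continuous f) {z x : E} {ε : ℝ}
    (hε : 0 < ε) (hx : x ∈ Metric.ball z ε) :
    ‖f x - ⨍ y in Metric.ball z ε, f y‖ₑ ^ 2 ≤ (volume (Metric.ball (0 : E) ε))⁻¹ *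
      ∫⁻ h in Metric.ball (0 : E) (2 * ε), ‖f (x + h) - f x‖ₑ ^ 2 := by
  set μ := volume.restrict (Metric.ball z ε) with hμ
  have : IsFiniteMeasure μ := ⟨by simpa [hμ] using measure_ball_lt_top⟩
  have : NeZero μ := ⟨by
    rw [hμ, Ne, Measure.restrict_eq_zero]; exact (Metric.measure_ball_pos _ _ hε).ne'⟩
  have hint : Integrable f μ :=
    (hf.continuousOn.integrableOn_compact (isCompact_closedBall z ε)).mono_set
      Metric.ball_subset_closedBall
  have hint' : Integrable f ((μ Set.univ)⁻¹ • μ) := hint.smul_measure (by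
    simpa using NeZero.ne μ)
  have hmeas : Measurable fun y => ‖f y - f x‖ₑ := (hf.sub continuous_const).enorm.measurable
  have h1 : ‖f x - ⨍ y, f y ∂μ‖ₑ ≤ ∫⁻ y, ‖f y - f x‖ₑ ∂((μ Set.univ)⁻¹ • μ) := by
    have : f x - ⨍ y, f y ∂μ = -∫ y, (f y - f x) ∂((μ Set.univ)⁻¹ • μ) := by
      rw [average_eq', integral_sub hint' (integrable_const _)]
      simp
    rw [this, enorm_neg]
    exact enorm_integral_le_lintegral_enorm _
  calc _ ≤ (∫⁻ y, ‖f y - f x‖ₑ ∂((μ Set.univ)⁻¹ • μ)) ^ 2 := pow_le_pow_left' h1 2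
    _ ≤ ∫⁻ y, ‖f y - f x‖ₑ ^ 2 ∂((μ Set.univ)⁻¹ • μ) := by
      simpa using lintegral_sq_le_measure_univ_mul
        (ν := (μ Set.univ)⁻¹ • μ) hmeas.aemeasurable
    _ = (volume (Metric.ball (0 : E) ε))⁻¹ * ∫⁻ y in Metric.ball z ε, ‖f y - f x‖ₑ ^ 2 := by
      rw [lintegral_smul_measure, smul_eq_mul, hμ, Measure.restrict_apply_univ,
        Measure.addHaar_ball_center]
    _ ≤ _ := by
      refine mul_le_mul' le_rfl ?_
      rw [← lintegral_indicator measurableSet_ball, ← lintegral_indicator measurableSet_ball,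
        ← lintegral_add_left_eq_self _ x]
      refine lintegral_mono fun h => ?_
      by_cases hh : x + h ∈ Metric.ball z ε
      · have : h ∈ Metric.ball (0 : E) (2 * ε) := by
          rw [mem_ball_zero_iff]
          rw [Metric.mem_ball] at hx hh
          have := dist_triangle_right (x + h) x z
          rw [dist_eq_norm, add_sub_cancel_left] at this
          linarith
        rw [Set.indicator_of_mem hh, Set.indicator_of_mem this]
      · rw [Set.indicator_of_notMem hh]; exact zero_le

/-- Up to a small multiple of the Dirichlet energy, the `L²` norm on a bounded set is controlled
by finitely many averages. -/
theorem exists_finset_lintegral_enorm_sq_le (hN : 0 < N) {Ω : Set E} (hΩ : Bornology.IsBounded Ω)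
    (hΩm : MeasurableSet Ω) {η : ℝ} (hη : 0 < η) : ∃ (t : Finset E) (ε c : ℝ), 0 ≤ c ∧
      ∀ f : E → ℝ, ContDiff ℝ 1 f → ∫⁻ x in Ω, ‖f x‖ₑ ^ 2 ≤
        ENNReal.ofReal η * (∫⁻ x, ‖gradient f x‖ₑ ^ 2) +
        ENNReal.ofReal c * ∑ z ∈ t, ‖∫ y in Metric.ball z ε, f y‖ₑ ^ 2 := by
  have : Nonempty (Fin N) := ⟨⟨0, hN⟩⟩
  -- The energy coefficient found below is 4 · 2^N · (2ε)² = 16 · 2^N ε², which this choice makes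
  -- equal to η.
  set ε : ℝ := Real.sqrt (η / (16 * 2 ^ N)) with hε
  have hε0 : 0 < ε := Real.sqrt_pos.2 (by positivity)
  have hε2 : ε ^ 2 = η / (16 * 2 ^ N) := Real.sq_sqrt (by positivity)
  obtain ⟨s, hs, hcov⟩ := Metric.totallyBounded_iff.1
    (hΩ.isCompact_closure.totallyBounded.subset subset_closure) ε hε0
  set V := volume (Metric.ball (0 : E) ε) with hV
  have hV0 : V ≠ 0 := (Metric.measure_ball_pos _ _ hε0).ne'
  have hVt : V ≠ ⊤ := measure_ball_lt_top.ne
  set c : ENNReal := 4 * volume Ω * (V⁻¹) ^ 2 with hc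
  have hct : c ≠ ⊤ := ENNReal.mul_ne_top
    (ENNReal.mul_ne_top (by simp) hΩ.measure_lt_top.ne) (by simp [hV0])
  refine ⟨hs.toFinset, ε, c.toReal, ENNReal.toReal_nonneg, fun f hf => ?_⟩
  rw [ENNReal.ofReal_toReal hct]
  set J : E → ENNReal := fun x => ∫⁻ h in Metric.ball (0 : E) (2 * ε), ‖f (x + h) - f x‖ₑ ^ 2
    with hJ
  set G := ∫⁻ x, ‖gradient f x‖ₑ ^ 2 with hG
  set M : ENNReal := ∑ z ∈ hs.toFinset, ‖∫ y in Metric.ball z ε, f y‖ₑ ^ 2 with hM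
  have hmeas : Measurable (Function.uncurry fun x h : E => ‖f (x + h) - f x‖ₑ ^ 2) := by
    have h1 := hf.continuous
    have : Continuous (Function.uncurry fun x h : E => f (x + h) - f x) := by
      simp only [Function.uncurry_def]; fun_prop
    exact this.enorm.measurable.pow_const 2
  have hJm : Measurable J := hmeas.lintegral_prod_right
  -- Compare f(x) with its average over a covering ball containing x; summing over all centres
  -- removes the dependence on that ball.
  have hpt : ∀ x ∈ Ω, ‖f x‖ₑ ^ 2 ≤ 4 * V⁻¹ * J x + 4 * (V⁻¹) ^ 2 * M := by
    intro x hx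
    obtain ⟨z, hz, hxz⟩ := Set.mem_iUnion₂.1 (hcov hx)
    have h1 := enorm_sub_average_sq_le hf.continuous hε0 hxz
    set m := ⨍ y in Metric.ball z ε, f y with hm
    have h2 : ‖m‖ₑ ^ 2 ≤ (V⁻¹) ^ 2 * M := by
      rw [hm, average_eq, enorm_smul, mul_pow]
      gcongr
      · rw [measureReal_def, ← ENNReal.toReal_inv, Measure.restrict_apply_univ,
          Measure.addHaar_ball_center, Real.enorm_of_nonneg ENNReal.toReal_nonneg,
          ENNReal.ofReal_toReal (ENNReal.inv_ne_top.2 hV0)]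
      · exact Finset.single_le_sum (f := fun z => ‖∫ y in Metric.ball z ε, f y‖ₑ ^ 2)
          (fun _ _ => zero_le) (hs.mem_toFinset.2 hz)
    calc ‖f x‖ₑ ^ 2 = ‖(f x - m) + m‖ₑ ^ 2 := by rw [sub_add_cancel]
      _ ≤ (‖f x - m‖ₑ + ‖m‖ₑ) ^ 2 := pow_le_pow_left' (enorm_add_le _ _) 2
      _ ≤ 4 * (‖f x - m‖ₑ ^ 2 + ‖m‖ₑ ^ 2) := ENNReal.add_sq_le_four_mul _ _
      _ ≤ 4 * (V⁻¹ * J x + (V⁻¹) ^ 2 * M) := by gcongr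
      _ = _ := by ring
  have hJint : ∫⁻ x, J x ≤ volume (Metric.ball (0 : E) (2 * ε)) *
      (ENNReal.ofReal (2 * ε) ^ 2 * G) := by
    rw [hJ, lintegral_lintegral_swap hmeas.aemeasurable, mul_comm (volume _), ← setLIntegral_const]
    refine setLIntegral_mono' measurableSet_ball fun h hh => ?_
    refine (lintegral_enorm_translate_sub_sq_le hf h).trans ?_
    gcongr
    rw [← ofReal_norm]
    exact ENNReal.ofReal_le_ofReal (mem_ball_zero_iff.1 hh).le
  calc ∫⁻ x in Ω, ‖f x‖ₑ ^ 2 ≤ ∫⁻ x in Ω, (4 * V⁻¹ * J x + 4 * (V⁻¹) ^ 2 * M) :=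
        setLIntegral_mono' hΩm hpt
    _ = 4 * V⁻¹ * (∫⁻ x in Ω, J x) + 4 * (V⁻¹) ^ 2 * M * volume Ω := by
        rw [lintegral_add_right _ measurable_const, lintegral_const_mul _ hJm, setLIntegral_const]
    _ ≤ 4 * V⁻¹ * (volume (Metric.ball (0 : E) (2 * ε)) * (ENNReal.ofReal (2 * ε) ^ 2 * G)) +
        4 * (V⁻¹) ^ 2 * M * volume Ω := by
        gcongr
        exact (setLIntegral_le_lintegral _ _).trans hJint
    _ = _ := by
        congr 1
        · rw [Measure.addHaar_ball_mul volume _ (by norm_num : (0 : ℝ) ≤ 2), ← hV,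
            finrank_euclideanSpace_fin]
          have : 4 * V⁻¹ * (ENNReal.ofReal (2 ^ N) * V * (ENNReal.ofReal (2 * ε) ^ 2 * G)) =
              (V⁻¹ * V) * (4 * ENNReal.ofReal (2 ^ N) * ENNReal.ofReal (2 * ε) ^ 2) * G := by ring
          rw [this, ENNReal.inv_mul_cancel hV0 hVt, one_mul]
          congr 1
          rw [← ENNReal.ofReal_pow (by positivity), show (4 : ENNReal) = ENNReal.ofReal 4 by simp,
            ← ENNReal.ofReal_mul (by norm_num), ← ENNReal.ofReal_mul (by positivity), mul_pow, hε2]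
          congr 1
          field_simp; norm_num
        · rw [hc]; ring

end Sobolev

/-! ### Test functions as a subspace of L² × L², Rellich, and the first eigenfunction -/

section Dirichlet

variable {N : ℕ} {Ω : Set (EuclideanSpace ℝ (Fin N))}

local notation "E" => EuclideanSpace ℝ (Fin N)

theorem IsTestFunction.continuous_gradient {φ : E → ℝ} (hφ : IsTestFunction Ω φ) :
    Continuous (gradient φ) :=
  (InnerProductSpace.toDual ℝ E).symm.continuous.comp
    ((hφ.1.of_le (by simp)).continuous_fderiv one_ne_zero)

theorem support_gradient_subset (φ : E → ℝ) : Function.support (gradient φ) ⊆ tsupport φ := by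
  intro x hx
  refine support_fderiv_subset ℝ (f := φ) ?_
  contrapose! hx
  simpa [gradient] using hx

theorem IsTestFunction.memLp {φ : E → ℝ} (hφ : IsTestFunction Ω φ) (p : ENNReal) :
    MemLp φ p (volume.restrict Ω) :=
  (hφ.1.continuous.memLp_of_hasCompactSupport hφ.2.1).restrict _

theorem IsTestFunction.memLp_gradient {φ : E → ℝ} (hφ : IsTestFunction Ω φ) (p : ENNReal) :
    MemLp (gradient φ) p (volume.restrict Ω) :=
  (hφ.continuous_gradient.memLp_of_hasCompactSupport
    (hφ.2.1.mono' (support_gradient_subset φ))).restrict _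

theorem gradient_add_smul {φ ψ : E → ℝ} (hφ : Differentiable ℝ φ) (hψ : Differentiable ℝ ψ)
    (c : ℝ) (x : E) :
    gradient (fun y => φ y + c * ψ y) x = gradient φ x + c • gradient ψ x := by
  simp only [gradient]
  rw [fderiv_fun_add (hφ x) ((hψ x).const_mul c), fderiv_const_mul (hψ x)]
  simp

theorem IsTestFunction.zero : IsTestFunction Ω (fun _ => 0) :=
  ⟨contDiff_const, HasCompactSupport.zero, by simp [tsupport]⟩

theorem IsTestFunction.add_smul {φ ψ : E → ℝ} (hφ : IsTestFunction Ω φ)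
    (hψ : IsTestFunction Ω ψ) (c : ℝ) : IsTestFunction Ω (fun x => φ x + c * ψ x) := by
  refine ⟨hφ.1.add (contDiff_const.mul hψ.1), hφ.2.1.add (hψ.2.1.mul_left (f := fun _ => c)), ?_⟩
  refine (tsupport_add φ fun x => c * ψ x).trans (Set.union_subset hφ.2.2 ?_)
  exact (closure_mono (Function.support_mul_subset_right (fun _ => c) ψ)).trans hψ.2.2

theorem IsTestFunction.differentiable {φ : E → ℝ} (hφ : IsTestFunction Ω φ) :
    Differentiable ℝ φ := hφ.1.differentiable (by simp)

theorem IsTestFunction.lintegral_gradient {φ : E → ℝ} (hφ : IsTestFunction Ω φ)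
    (hΩ : MeasurableSet Ω) :
    ∫⁻ x in Ω, ‖gradient φ x‖ₑ ^ 2 = ∫⁻ x, ‖gradient φ x‖ₑ ^ 2 := by
  rw [← lintegral_indicator hΩ, Set.indicator_eq_self.2]
  intro x hx
  refine hφ.2.2 (support_gradient_subset φ ?_)
  contrapose! hx
  simpa using hx

theorem lintegral_enorm_sq_congr {α F : Type*} [MeasurableSpace α] {ν : Measure α}
    [NormedAddCommGroup F] {f g : α → F} (h : f =ᵐ[ν] g) :
    ∫⁻ x, ‖f x‖ₑ ^ 2 ∂ν = ∫⁻ x, ‖g x‖ₑ ^ 2 ∂ν :=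
  lintegral_congr_ae (by filter_upwards [h] with x hx; rw [hx])

theorem MeasureTheory.Lp.ofReal_norm_sq {α F : Type*} [MeasurableSpace α] {ν : Measure α}
    [NormedAddCommGroup F] (f : Lp F 2 ν) :
    ENNReal.ofReal (‖f‖ ^ 2) = ∫⁻ x, ‖f x‖ₑ ^ 2 ∂ν := by
  have h := eLpNorm_nnreal_pow_eq_lintegral (f := f) (μ := ν) (p := 2) (by norm_num)
  rw [ENNReal.ofReal_pow (norm_nonneg _), ofReal_norm, Lp.enorm_def]
  simpa using h

/-- The pairs `(φ, ∇φ)` in `L²(Ω) × L²(Ω)^N`, for test functions `φ`. -/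
noncomputable def testGraph (Ω : Set (EuclideanSpace ℝ (Fin N))) :
    Submodule ℝ (Lp ℝ 2 (volume.restrict Ω) ×
      Lp (EuclideanSpace ℝ (Fin N)) 2 (volume.restrict Ω)) where
  carrier := {w | ∃ φ, IsTestFunction Ω φ ∧ w.1 =ᵐ[volume.restrict Ω] φ ∧
    w.2 =ᵐ[volume.restrict Ω] gradient φ}
  zero_mem' := ⟨_, IsTestFunction.zero, Lp.coeFn_zero _ _ _, by
    filter_upwards [Lp.coeFn_zero E 2 (volume.restrict Ω)] with x hx
    simpa [gradient] using hx⟩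
  add_mem' := by
    rintro w z ⟨φ, hφ, h1, h2⟩ ⟨ψ, hψ, h3, h4⟩
    refine ⟨_, hφ.add_smul hψ 1, ?_, ?_⟩
    · filter_upwards [Lp.coeFn_add w.1 z.1, h1, h3] with x hx h1 h3
      rw [Prod.fst_add, hx, Pi.add_apply, h1, h3, one_mul]
    · filter_upwards [Lp.coeFn_add w.2 z.2, h2, h4] with x hx h2 h4
      rw [gradient_add_smul hφ.differentiable hψ.differentiable]
      rw [Prod.snd_add, hx, Pi.add_apply, h2, h4, one_smul]
  smul_mem' := by
    rintro c z ⟨ψ, hψ, h3, h4⟩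
    refine ⟨_, IsTestFunction.zero.add_smul hψ c, ?_, ?_⟩
    · filter_upwards [Lp.coeFn_smul c z.1, h3] with x hx h3
      simp [hx, h3]
    · filter_upwards [Lp.coeFn_smul c z.2, h4] with x hx h4
      rw [gradient_add_smul (IsTestFunction.zero (Ω := Ω)).differentiable hψ.differentiable]
      simp [hx, h4, gradient]

/-- The pairs `(φ, ∇φ)` for nonnegative test functions `φ`. -/
def nonnegTestGraph (Ω : Set (EuclideanSpace ℝ (Fin N))) :
    Set (Lp ℝ 2 (volume.restrict Ω) × Lp (EuclideanSpace ℝ (Fin N)) 2 (volume.restrict Ω)) :=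
  {w | ∃ φ, IsTestFunction Ω φ ∧ (∀ x, 0 ≤ φ x) ∧ w.1 =ᵐ[volume.restrict Ω] φ ∧
    w.2 =ᵐ[volume.restrict Ω] gradient φ}

theorem nonnegTestGraph_subset : nonnegTestGraph Ω ⊆ testGraph Ω :=
  fun _ ⟨φ, hφ, _, h1, h2⟩ => ⟨φ, hφ, h1, h2⟩

theorem mem_testGraph {φ : E → ℝ} (hφ : IsTestFunction Ω φ) :
    ((hφ.memLp 2).toLp φ, (hφ.memLp_gradient 2).toLp (gradient φ)) ∈ testGraph Ω :=
  ⟨φ, hφ, (hφ.memLp 2).coeFn_toLp, (hφ.memLp_gradient 2).coeFn_toLp⟩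

theorem exists_poincare (hN : 0 < N) (hΩ : MeasurableSet Ω) (hb : Bornology.IsBounded Ω) :
    ∃ P > 0, ∀ w ∈ testGraph Ω, ‖w.1‖ ^ 2 ≤ P * ‖w.2‖ ^ 2 := by
  obtain ⟨R, hR, hsub⟩ := hb.subset_ball_lt 0 0
  refine ⟨(2 * R) ^ 2, by positivity, ?_⟩
  rintro w ⟨φ, hφ, h1, h2⟩
  have h := lintegral_enorm_sq_le_of_support_subset_ball hN (hφ.1.of_le (by simp)) hR
    ((subset_tsupport φ).trans (hφ.2.2.trans hsub))
  rw [← ENNReal.ofReal_le_ofReal_iff (by positivity), ENNReal.ofReal_mul (by positivity),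
    Lp.ofReal_norm_sq, Lp.ofReal_norm_sq, ENNReal.ofReal_pow (by positivity)]
  rw [lintegral_enorm_sq_congr h1,
    lintegral_enorm_sq_congr h2, hφ.lintegral_gradient hΩ]
  exact (setLIntegral_le_lintegral _ _).trans h

theorem exists_finset_norm_sq_le (hN : 0 < N) (hΩ : MeasurableSet Ω)
    (hb : Bornology.IsBounded Ω) {η : ℝ} (hη : 0 < η) :
    ∃ (t : Finset (Lp ℝ 2 (volume.restrict Ω))) (c : ℝ), 0 ≤ c ∧
      ∀ w ∈ testGraph Ω, ‖w.1‖ ^ 2 ≤ η * ‖w.2‖ ^ 2 + c * ∑ a ∈ t, (inner ℝ a w.1) ^ 2 := by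
  classical
  obtain ⟨t, ε, c, hc, h⟩ := exists_finset_lintegral_enorm_sq_le hN hb hΩ hη
  have hfin : ∀ z : E, (volume.restrict Ω) (Metric.ball z ε) ≠ ⊤ := fun z =>
    ((Measure.restrict_apply_le _ _).trans_lt measure_ball_lt_top).ne
  set I : E → Lp ℝ 2 (volume.restrict Ω) := fun z =>
    indicatorConstLp 2 (measurableSet_ball (x := z) (ε := ε)) (hfin z) (1 : ℝ) with hI
  refine ⟨t.image I, c * t.card, by positivity, ?_⟩
  rintro w ⟨φ, hφ, h1, h2⟩
  have hint : ∀ z, ∫ y in Metric.ball z ε, φ y = inner ℝ (I z) w.1 := by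
    intro z
    rw [hI, L2.inner_indicatorConstLp_one, Measure.restrict_restrict measurableSet_ball,
      integral_congr_ae (ae_restrict_of_ae_restrict_of_subset Set.inter_subset_right h1)]
    refine setIntegral_eq_of_subset_of_forall_sdiff_eq_zero measurableSet_ball
      Set.inter_subset_left fun x hx => ?_
    by_contra hne
    exact hx.2 ⟨hx.1, hφ.2.2 (subset_tsupport φ hne)⟩
  have h3 := h φ (hφ.1.of_le (by simp))
  have h4 : ∑ z ∈ t, ‖∫ y in Metric.ball z ε, φ y‖ₑ ^ 2 ≤
      ENNReal.ofReal (t.card * ∑ a ∈ t.image I, (inner ℝ a w.1) ^ 2) := by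
    rw [ENNReal.ofReal_mul (by positivity), ENNReal.ofReal_natCast, ← nsmul_eq_mul]
    refine Finset.sum_le_card_nsmul _ _ _ fun z hz => ?_
    rw [hint, ← ofReal_norm, ← ENNReal.ofReal_pow (norm_nonneg _), Real.norm_eq_abs, sq_abs]
    exact ENNReal.ofReal_le_ofReal (Finset.single_le_sum (f := fun a => (inner ℝ a w.1) ^ 2)
      (fun _ _ => sq_nonneg _) (Finset.mem_image_of_mem I hz))
  rw [← ENNReal.ofReal_le_ofReal_iff (by positivity), ENNReal.ofReal_add (by positivity)
    (by positivity), mul_assoc c, ENNReal.ofReal_mul hη.le, ENNReal.ofReal_mul hc,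
    Lp.ofReal_norm_sq, Lp.ofReal_norm_sq,
    lintegral_enorm_sq_congr h1,
    lintegral_enorm_sq_congr h2, hφ.lintegral_gradient hΩ]
  exact h3.trans (by gcongr)

/-- The Rellich theorem: `H_0^1(Ω) → L²(Ω)` is compact. -/
theorem totallyBounded_testGraph (hN : 0 < N) (hΩ : MeasurableSet Ω)
    (hb : Bornology.IsBounded Ω) (C : ℝ) :
    TotallyBounded (Prod.fst '' {w | w ∈ testGraph Ω ∧ ‖w.2‖ ≤ C}) :=
  let ⟨_, _, hP⟩ := exists_poincare hN hΩ hb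
  totallyBounded_fst_image _ hP (fun _ hη => exists_finset_norm_sq_le hN hΩ hb hη) C

/-- A smooth substitute for |φ|: subtracting ε makes it vanish where φ does, so the support does not
grow. -/
theorem IsTestFunction.smoothAbs {φ : E → ℝ} (hφ : IsTestFunction Ω φ) {ε : ℝ} (hε : 0 < ε) :
    IsTestFunction Ω (fun x => Real.sqrt (φ x ^ 2 + ε ^ 2) - ε) := by
  have h0 : Real.sqrt ((0 : ℝ) ^ 2 + ε ^ 2) - ε = 0 := by simp [Real.sqrt_sq hε.le]
  exact ⟨(((hφ.1.pow 2).add contDiff_const).sqrt fun x => by positivity).sub contDiff_const,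
    hφ.2.1.comp_left (g := fun t : ℝ => Real.sqrt (t ^ 2 + ε ^ 2) - ε) h0,
    (tsupport_comp_subset (g := fun t : ℝ => Real.sqrt (t ^ 2 + ε ^ 2) - ε) h0 φ).trans hφ.2.2⟩

theorem norm_gradient_smoothAbs_le {φ : E → ℝ} (hφ : Differentiable ℝ φ) {ε : ℝ} (hε : 0 < ε)
    (x : E) : ‖gradient (fun x => Real.sqrt (φ x ^ 2 + ε ^ 2) - ε) x‖ ≤ ‖gradient φ x‖ := by
  have h1 : HasDerivAt (fun t : ℝ => Real.sqrt (t ^ 2 + ε ^ 2) - ε)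
      (φ x / Real.sqrt (φ x ^ 2 + ε ^ 2)) (φ x) := by
    have := (((hasDerivAt_pow 2 (φ x)).add_const (ε ^ 2)).sqrt (by positivity)).sub_const ε
    refine this.congr_deriv ?_
    have : Real.sqrt (φ x ^ 2 + ε ^ 2) ≠ 0 := by positivity
    field_simp
    simp
  have h2 := h1.comp_hasFDerivAt x (hφ x).hasFDerivAt
  rw [norm_gradient_eq_norm_fderiv, norm_gradient_eq_norm_fderiv]
  rw [show (fun x => Real.sqrt (φ x ^ 2 + ε ^ 2) - ε) =
    (fun t : ℝ => Real.sqrt (t ^ 2 + ε ^ 2) - ε) ∘ φ from rfl, h2.fderiv, norm_smul]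
  refine mul_le_of_le_one_left (norm_nonneg _) ?_
  rw [norm_div, Real.norm_eq_abs, Real.norm_of_nonneg (Real.sqrt_nonneg _)]
  exact div_le_one_of_le₀ (Real.abs_le_sqrt (by nlinarith)) (Real.sqrt_nonneg _)

/-- The smoothed absolute value does not increase the energy, since t ↦ √(t² + ε²) is 1-Lipschitz.
It lies between |φ| - ε and |φ|, so on a set of finite measure the L² norm drops by little. -/
theorem exists_mem_nonnegTestGraph (hb : Bornology.IsBounded Ω)
    {w : Lp ℝ 2 (volume.restrict Ω) × Lp E 2 (volume.restrict Ω)} (hw : w ∈ testGraph Ω)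
    {δ : ℝ} (hδ : 0 < δ) :
    ∃ s ∈ nonnegTestGraph Ω, ‖s.2‖ ≤ ‖w.2‖ ∧ ‖s.1‖ ≤ ‖w.1‖ ∧ ‖w.1‖ - δ ≤ ‖s.1‖ := by
  obtain ⟨φ, hφ, h1, h2⟩ := hw
  have : IsFiniteMeasure (volume.restrict Ω) := ⟨by simpa using hb.measure_lt_top⟩
  set M : ℝ := (measureUnivNNReal (volume.restrict Ω) : ℝ) ^ (ENNReal.toReal 2)⁻¹ with hM
  have hM0 : 0 ≤ M := by positivity
  -- The L² loss is at most |Ω|^{1/2} ε = M ε ≤ δ.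
  set ε := δ / (M + 1) with hε
  have hε0 : 0 < ε := by positivity
  have hψ := hφ.smoothAbs hε0
  set ψ : E → ℝ := fun x => Real.sqrt (φ x ^ 2 + ε ^ 2) - ε with hψd
  have hψ0 : ∀ x, 0 ≤ ψ x := fun x => sub_nonneg.2 (Real.le_sqrt_of_sq_le (by nlinarith))
  have hψ1 : ∀ x, ψ x ≤ |φ x| := fun x => by
    rw [hψd, sub_le_iff_le_add, Real.sqrt_le_left (by positivity), add_sq, sq_abs]
    have := mul_nonneg (abs_nonneg (φ x)) hε0.le
    linarith
  have hψ2 : ∀ x, |φ x| - ψ x ≤ ε := fun x => by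
    have : |φ x| ≤ Real.sqrt (φ x ^ 2 + ε ^ 2) := Real.abs_le_sqrt (by nlinarith)
    simp only [hψd]; linarith
  refine ⟨((hψ.memLp 2).toLp ψ, (hψ.memLp_gradient 2).toLp (gradient ψ)),
    ⟨ψ, hψ, hψ0, (hψ.memLp 2).coeFn_toLp, (hψ.memLp_gradient 2).coeFn_toLp⟩, ?_, ?_, ?_⟩
  · refine Lp.norm_le_norm_of_ae_le ?_
    filter_upwards [h2, (hψ.memLp_gradient 2).coeFn_toLp] with x hx hx'
    rw [hx, hx']
    exact norm_gradient_smoothAbs_le hφ.differentiable hε0 x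
  · refine Lp.norm_le_norm_of_ae_le ?_
    filter_upwards [h1, (hψ.memLp 2).coeFn_toLp] with x hx hx'
    rw [hx, hx', Real.norm_of_nonneg (hψ0 x)]
    exact hψ1 x
  · have h3 : ‖|w.1| - (hψ.memLp 2).toLp ψ‖ ≤ M * ε := by
      refine Lp.norm_le_of_ae_bound hε0.le ?_
      filter_upwards [h1, (hψ.memLp 2).coeFn_toLp, Lp.coeFn_abs w.1,
        Lp.coeFn_sub |w.1| ((hψ.memLp 2).toLp ψ)] with x a1 a2 a3 a4
      rw [a4, Pi.sub_apply, a3, a1, a2, Real.norm_of_nonneg (sub_nonneg.2 (hψ1 x))]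
      exact hψ2 x
    have h4 : M * ε ≤ δ := by
      rw [hε, mul_div_assoc', div_le_iff₀ (by positivity)]; nlinarith
    have h5 := norm_sub_norm_le |w.1| ((hψ.memLp 2).toLp ψ)
    rw [norm_abs_eq_norm] at h5
    linarith

theorem exists_mem_testGraph_ne_zero (hΩ : IsOpen Ω) (hne : Ω.Nonempty) :
    ∃ w ∈ testGraph Ω, w.1 ≠ 0 := by
  obtain ⟨x, hx⟩ := hne
  obtain ⟨φ, h1, h2, h3, -, h4⟩ :=
    exists_contDiff_tsupport_subset (n := ⊤) (hΩ.mem_nhds hx)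
  have hφ : IsTestFunction Ω φ := ⟨h3, h2, h1⟩
  refine ⟨_, mem_testGraph hφ, fun h0 => ?_⟩
  rw [Lp.eq_zero_iff_ae_eq_zero] at h0
  have h5 : φ =ᵐ[volume.restrict Ω] 0 := (hφ.memLp 2).coeFn_toLp.symm.trans h0
  have h6 : φ =ᵐ[volume] fun _ => (0 : ℝ) := by
    filter_upwards [(ae_restrict_iff' hΩ.measurableSet).1 h5] with y hy
    by_contra hne
    exact hne (hy (h1 (subset_tsupport φ hne)))
  have := congrFun ((h3.continuous.ae_eq_iff_eq volume continuous_const).1 h6) x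
  simp [h4] at this

/-- A nonnegative first eigenfunction, as an element of `L²(Ω) × L²(Ω)^N`. -/
theorem exists_first_eigenpair (hN : 0 < N) (hΩ : IsOpen Ω) (hne : Ω.Nonempty)
    (hb : Bornology.IsBounded Ω) : ∃ lam > 0,
      (∀ w ∈ (testGraph Ω).topologicalClosure, lam * ‖w.1‖ ^ 2 ≤ ‖w.2‖ ^ 2) ∧
      ∃ w ∈ closure (nonnegTestGraph Ω), ‖w.1‖ = 1 ∧
        ∀ z ∈ (testGraph Ω).topologicalClosure, inner ℝ w.2 z.2 = lam * inner ℝ w.1 z.1 := by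
  obtain ⟨lam, hlow, w, hw, hw1, hw2⟩ := exists_rayleigh_minimizer (testGraph Ω)
    (nonnegTestGraph Ω) nonnegTestGraph_subset (exists_mem_testGraph_ne_zero hΩ hne)
    (fun w hw δ hδ => exists_mem_nonnegTestGraph hb hw hδ)
    (totallyBounded_testGraph hN hΩ.measurableSet hb)
  have hclos : ∀ (a b : ℝ), (∀ w ∈ testGraph Ω, a * ‖w.1‖ ^ 2 ≤ b * ‖w.2‖ ^ 2) →
      ∀ w ∈ (testGraph Ω).topologicalClosure, a * ‖w.1‖ ^ 2 ≤ b * ‖w.2‖ ^ 2 := by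
    intro a b h w hw
    have hcl : IsClosed {w : Lp ℝ 2 (volume.restrict Ω) × Lp E 2 (volume.restrict Ω) |
        a * ‖w.1‖ ^ 2 ≤ b * ‖w.2‖ ^ 2} := isClosed_le (by fun_prop) (by fun_prop)
    exact hcl.closure_subset_iff.2 (fun z hz => h z hz) hw
  have hwD : w ∈ (testGraph Ω).topologicalClosure := closure_mono nonnegTestGraph_subset hw
  have hlow' : ∀ w ∈ (testGraph Ω).topologicalClosure, lam * ‖w.1‖ ^ 2 ≤ ‖w.2‖ ^ 2 := by
    simpa using hclos lam 1 (by simpa using hlow)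
  obtain ⟨P, hP, hPw⟩ := exists_poincare hN hΩ.measurableSet hb
  -- At the normalized minimizer Poincaré reads 1 ≤ P · `lam`.
  have hpos : 0 < lam := by
    have := hclos 1 P (by simpa using hPw) w hwD
    rw [hw1, hw2] at this
    by_contra hneg
    nlinarith
  exact ⟨lam, hpos, hlow', w, hw, hw1, fun z hz =>
    inner_eq_of_rayleigh_minimizer hlow' hwD hz (by rw [hw1, hw2]; ring)⟩

end Dirichlet

/-! ### Weak equations as identities on a closed subspace of L² × L² -/

section Eigenvalues

variable {N : ℕ} {Ω : Set (EuclideanSpace ℝ (Fin N))}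

local notation "E" => EuclideanSpace ℝ (Fin N)

/-- An element of `H_0^1(Ω)` together with its gradient, as an element of `L²(Ω) × L²(Ω)^N`. -/
noncomputable def H01.pair (u : H01 Ω) :
    Lp ℝ 2 (volume.restrict Ω) × Lp (EuclideanSpace ℝ (Fin N)) 2 (volume.restrict Ω) :=
  (u.memLp_toFun.toLp u.toFun, u.memLp_grad.toLp u.grad)

theorem H01.pair_mem (u : H01 Ω) : u.pair ∈ (testGraph Ω).topologicalClosure := by
  obtain ⟨φ, hφ, h1, h2⟩ := u.exists_approx
  refine mem_closure_of_tendsto (Tendsto.prodMk_nhds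
    ((Lp.tendsto_Lp_iff_tendsto_eLpNorm'' φ (fun n => (hφ n).memLp 2) u.toFun u.memLp_toFun).2 h1)
    ((Lp.tendsto_Lp_iff_tendsto_eLpNorm'' (fun n => gradient (φ n))
      (fun n => (hφ n).memLp_gradient 2) u.grad u.memLp_grad).2 h2))
    (Eventually.of_forall fun n => mem_testGraph (hφ n))

/-- With `H01.pair_mem`, this identifies H_0^1(Ω), up to a.e. equality, with the closed subspace, so
that testing against either is equivalent. -/
theorem exists_H01_pair_eq {w : Lp ℝ 2 (volume.restrict Ω) × Lp E 2 (volume.restrict Ω)}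
    (hw : w ∈ (testGraph Ω).topologicalClosure) : ∃ u : H01 Ω, u.pair = w := by
  obtain ⟨s, hs, hlim⟩ := mem_closure_iff_seq_limit.1 hw
  choose φ hφ h1 h2 using hs
  have e1 := (Lp.tendsto_Lp_iff_tendsto_eLpNorm' _ _).1 (hlim.fst_nhds)
  have e2 := (Lp.tendsto_Lp_iff_tendsto_eLpNorm' _ _).1 (hlim.snd_nhds)
  refine ⟨⟨w.1, w.2, Lp.memLp _, Lp.memLp _, φ, hφ, e1.congr fun n => ?_, e2.congr fun n => ?_⟩, ?_⟩
  · exact eLpNorm_congr_ae ((h1 n).sub .rfl)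
  · exact eLpNorm_congr_ae ((h2 n).sub .rfl)
  · simp only [H01.pair, Lp.toLp_coeFn]

theorem H01.integral_inner_grad (u v : H01 Ω) :
    ∫ x in Ω, inner ℝ (u.grad x) (v.grad x) = inner ℝ u.pair.2 v.pair.2 := by
  rw [L2.inner_def]
  refine integral_congr_ae ?_
  filter_upwards [u.memLp_grad.coeFn_toLp, v.memLp_grad.coeFn_toLp] with x h1 h2
  simp only [H01.pair, h1, h2]

theorem H01.integral_mul (u v : H01 Ω) :
    ∫ x in Ω, u.toFun x * v.toFun x = inner ℝ u.pair.1 v.pair.1 := by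
  rw [L2.inner_def]
  refine integral_congr_ae ?_
  filter_upwards [u.memLp_toFun.coeFn_toLp, v.memLp_toFun.coeFn_toLp] with x h1 h2
  simp only [H01.pair, h1, h2, RCLike.inner_apply, conj_trivial, mul_comm]

theorem H01.integrable_mul (u v : H01 Ω) :
    Integrable (fun x => u.toFun x * v.toFun x) (volume.restrict Ω) :=
  u.memLp_toFun.integrable_mul v.memLp_toFun

theorem solvesDirichlet_const_mul_iff (u v : H01 Ω) (lam : ℝ) :
    SolvesDirichlet u (fun x => lam * v.toFun x) ↔ ∀ z ∈ (testGraph Ω).topologicalClosure,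
      inner ℝ u.pair.2 z.2 = lam * inner ℝ v.pair.1 z.1 := by
  have h : ∀ φ : H01 Ω, ∫ x in Ω, lam * v.toFun x * φ.toFun x =
      lam * inner ℝ v.pair.1 φ.pair.1 := fun φ => by
    rw [← H01.integral_mul, ← integral_const_mul]
    simp only [mul_assoc]
  constructor
  · intro hs z hz
    obtain ⟨φ, rfl⟩ := exists_H01_pair_eq hz
    rw [← H01.integral_inner_grad, hs φ, h]
  · intro hs φ
    rw [H01.integral_inner_grad, hs _ φ.pair_mem, h]

theorem isInverseLaplacian_iff (u v : H01 Ω) :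
    IsInverseLaplacian u v ↔ ∀ z ∈ (testGraph Ω).topologicalClosure,
      inner ℝ v.pair.2 z.2 = inner ℝ u.pair.1 z.1 := by
  simpa [IsInverseLaplacian] using solvesDirichlet_const_mul_iff v u 1

theorem H01.pair_fst_eq_zero_iff (u : H01 Ω) :
    u.pair.1 = 0 ↔ u.toFun =ᵐ[volume.restrict Ω] 0 := by
  rw [Lp.eq_zero_iff_ae_eq_zero]
  exact ⟨fun h => u.memLp_toFun.coeFn_toLp.symm.trans h, fun h => u.memLp_toFun.coeFn_toLp.trans h⟩

theorem nonneg_fst_of_mem_closure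
    {w : Lp ℝ 2 (volume.restrict Ω) × Lp E 2 (volume.restrict Ω)}
    (hw : w ∈ closure (nonnegTestGraph Ω)) : 0 ≤ w.1 := by
  have hcl : IsClosed {w : Lp ℝ 2 (volume.restrict Ω) × Lp E 2 (volume.restrict Ω) |
      0 ≤ w.1} := isClosed_le continuous_const continuous_fst
  refine hcl.closure_subset_iff.2 ?_ hw
  rintro z ⟨φ, -, h0, h1, -⟩
  refine (Lp.coeFn_nonneg _).1 ?_
  filter_upwards [h1] with x hx
  rw [hx]
  exact h0 x

/-! ### Sobolev embedding and integrability of the nonlinear term -/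

/-- The Sobolev embedding `H_0^1(Ω) ⊆ L^q(Ω)` for `1/2 - 1/N ≤ 1/q`. -/
theorem H01.memLp_of_sobolev (hN : 3 ≤ N) (hb : Bornology.IsBounded Ω)
    (u : H01 Ω) (q : NNReal) (hq : (2 : ℝ)⁻¹ - (N : ℝ)⁻¹ ≤ (q : ℝ)⁻¹) :
    MemLp u.toFun q (volume.restrict Ω) := by
  obtain ⟨φ, hφ, h1, h2⟩ := u.exists_approx
  set K : ENNReal := ↑(eLpNormLESNormFDerivOfLeConst ℝ (volume : Measure E) Ω 2 q)
  have hsob : ∀ n, eLpNorm (φ n) q (volume.restrict Ω) ≤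
      K * eLpNorm (gradient (φ n)) 2 (volume.restrict Ω) := by
    intro n
    have h := eLpNorm_le_eLpNorm_fderiv_of_le (volume : Measure E) (p := 2) (q := q)
      ((hφ n).1.of_le (by simp)) ((subset_tsupport _).trans (hφ n).2.2) (by norm_num)
      (by rw [finrank_euclideanSpace_fin]; exact_mod_cast hN)
      (by rw [finrank_euclideanSpace_fin]; simpa using hq) hb
    have e : eLpNorm (gradient (φ n)) 2 (volume.restrict Ω) =
        eLpNorm (fderiv ℝ (φ n)) 2 volume := by
      rw [eLpNorm_restrict_eq_of_support_subset
        ((support_gradient_subset (φ n)).trans (hφ n).2.2)]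
      exact eLpNorm_congr_norm_ae (.of_forall fun x => norm_gradient_eq_norm_fderiv _ x)
    rw [e]
    exact (eLpNorm_mono_measure _ Measure.restrict_le_self).trans h
  have hev : ∀ᶠ n in atTop, eLpNorm (φ n) q (volume.restrict Ω) ≤
      K * (1 + eLpNorm u.grad 2 (volume.restrict Ω)) := by
    filter_upwards [h2.eventually (gt_mem_nhds zero_lt_one)] with n hn
    refine (hsob n).trans (mul_le_mul' le_rfl ?_)
    have e : gradient (φ n) = (fun x => gradient (φ n) x - u.grad x) + u.grad := by
      ext1 x; simp
    rw [e]
    refine (eLpNorm_add_le (((hφ n).memLp_gradient 2).1.sub u.memLp_grad.1) u.memLp_grad.1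
      (by norm_num)).trans (add_le_add hn.le le_rfl)
  -- L² convergence yields an a.e. convergent subsequence, along which the uniform L^q bound passes
  -- to the limit by Fatou.
  obtain ⟨ns, hns, hae⟩ := (tendstoInMeasure_of_tendsto_eLpNorm (two_ne_zero)
    (fun n => ((hφ n).memLp 2).1) u.memLp_toFun.1 h1).exists_seq_tendsto_ae
  refine ⟨u.memLp_toFun.1, ?_⟩
  refine (Lp.eLpNorm_le_of_ae_tendsto (hns.tendsto_atTop.eventually hev)
    (fun n => ((hφ (ns n)).memLp 2).1) hae).trans_lt ?_
  exact ENNReal.mul_lt_top ENNReal.coe_lt_top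
    (ENNReal.add_lt_top.2 ⟨ENNReal.one_lt_top, u.memLp_grad.2⟩)

/-- Subcriticality or criticality means p + 1 ≤ 2N/(N - 2), so u and v lie in L^{p+1}, and a^p b ≤
a^{p+1} + b^{p+1}. Integrability is what allows the weak equation to be split and its nonlinear term
to be shown strictly positive. -/
theorem H01.integrable_rpow_mul (hN : 3 ≤ N)
    (hb : Bornology.IsBounded Ω) {p : ℝ} (hp : 1 < p)
    (hp_crit : p ≤ 2 * (N : ℝ) / ((N : ℝ) - 2) - 1) (u v : H01 Ω) :
    Integrable (fun x => |u.toFun x| ^ (p - 1) * u.toFun x * v.toFun x)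
      (volume.restrict Ω) := by
  have hN' : (3 : ℝ) ≤ N := by exact_mod_cast hN
  set q : NNReal := ⟨p + 1, by linarith⟩ with hq
  have hqc : (q : ℝ) = p + 1 := rfl
  have hq0 : q ≠ 0 := by rw [← NNReal.coe_ne_zero, hqc]; linarith
  have hexp : (2 : ℝ)⁻¹ - (N : ℝ)⁻¹ ≤ (q : ℝ)⁻¹ := by
    have e : (2 : ℝ)⁻¹ - (N : ℝ)⁻¹ = (2 * (N : ℝ) / ((N : ℝ) - 2))⁻¹ := by
      have : (N : ℝ) - 2 ≠ 0 := by linarith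
      field_simp
    rw [e, hqc]
    exact inv_anti₀ (by linarith) (by linarith)
  have hint : ∀ w : H01 Ω, Integrable (fun x => |w.toFun x| ^ (p + 1)) (volume.restrict Ω) := by
    intro w
    have := (w.memLp_of_sobolev hN hb q hexp).integrable_norm_rpow
      (by exact_mod_cast hq0) ENNReal.coe_ne_top
    simpa [hqc] using this
  have hm : AEStronglyMeasurable (fun x => |u.toFun x| ^ (p - 1) * u.toFun x * v.toFun x)
      (volume.restrict Ω) :=
    ((((Real.continuous_rpow_const (by linarith)).comp_aestronglyMeasurable
      u.memLp_toFun.1.norm).mul u.memLp_toFun.1).mul v.memLp_toFun.1)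
  refine ((hint u).add (hint v)).mono' hm (.of_forall fun x => ?_)
  set a := |u.toFun x| with ha
  set b := |v.toFun x| with hb'
  have ha0 : 0 ≤ a := abs_nonneg _
  have hb0 : 0 ≤ b := abs_nonneg _
  have e : ‖a ^ (p - 1) * u.toFun x * v.toFun x‖ = a ^ p * b := by
    rw [norm_mul, norm_mul, Real.norm_eq_abs, Real.norm_eq_abs, Real.norm_eq_abs, ← ha, ← hb',
      abs_of_nonneg (Real.rpow_nonneg ha0 _)]
    congr 1
    nth_rewrite 2 [← Real.rpow_one a]
    rw [← Real.rpow_add' ha0 (by linarith)]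
    congr 1; ring
  have hs : ∀ c : ℝ, 0 ≤ c → c ^ (p + 1) = c ^ p * c := fun c hc => by
    rw [Real.rpow_add' hc (by linarith), Real.rpow_one]
  rw [e]
  simp only [Pi.add_apply, ← ha, ← hb']
  rcases le_total a b with h | h
  · calc a ^ p * b ≤ b ^ p * b := by gcongr
      _ ≤ _ := by rw [← hs b hb0]; exact le_add_of_nonneg_left (Real.rpow_nonneg ha0 _)
  · calc a ^ p * b ≤ a ^ p * a := by gcongr
      _ ≤ _ := by rw [← hs a ha0]; exact le_add_of_nonneg_right (Real.rpow_nonneg hb0 _)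

/-! ### Eigenvalue bounds and nonexistence -/

/-- The smallest eigenvalue of the nonlocal problem is at least `lam ^ 2`, if `lam` is the best
constant in the Poincaré inequality. -/
theorem sq_le_of_mem_nonlocalEigenvalues {lam mu : ℝ} (hlam : 0 < lam)
    (hlow : ∀ w ∈ (testGraph Ω).topologicalClosure, lam * ‖w.1‖ ^ 2 ≤ ‖w.2‖ ^ 2)
    (hmu : mu ∈ nonlocalEigenvalues Ω) : lam ^ 2 ≤ mu := by
  obtain ⟨u, v, hu, hv, hs⟩ := hmu
  rw [isInverseLaplacian_iff] at hv
  rw [solvesDirichlet_const_mul_iff] at hs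
  -- The three tests give (∇v, ∇u) = ‖u‖², (∇u, ∇v) = μ‖v‖² and ‖∇v‖² = (u, v).
  have h1 := hv _ u.pair_mem
  have h2 := hs _ v.pair_mem
  have h3 := hv _ v.pair_mem
  rw [real_inner_self_eq_norm_sq] at h1 h2 h3
  rw [real_inner_comm, h1] at h2
  have h4 := hlow _ v.pair_mem
  rw [h3] at h4
  have h5 := real_inner_le_norm u.pair.1 v.pair.1
  have hu0 : 0 < ‖u.pair.1‖ := norm_pos_iff.2 fun h => hu (u.pair_fst_eq_zero_iff.1 h)
  have hv0 : 0 < ‖v.pair.1‖ := by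
    refine (norm_nonneg _).lt_of_ne fun h => ?_
    rw [← h] at h2
    nlinarith
  have h6 : lam * ‖v.pair.1‖ ≤ ‖u.pair.1‖ := by
    refine le_of_mul_le_mul_right ?_ hv0
    linarith
  have h7 : lam ^ 2 * ‖v.pair.1‖ ^ 2 ≤ mu * ‖v.pair.1‖ ^ 2 := by
    rw [← h2, ← mul_pow]
    exact pow_le_pow_left₀ (by positivity) h6 2
  exact le_of_mul_le_mul_right h7 (by positivity)

theorem le_of_mem_laplacianEigenvalues {lam mu : ℝ}
    (hlow : ∀ w ∈ (testGraph Ω).topologicalClosure, lam * ‖w.1‖ ^ 2 ≤ ‖w.2‖ ^ 2)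
    (hmu : mu ∈ laplacianEigenvalues Ω) : lam ≤ mu := by
  obtain ⟨u, hu, hs⟩ := hmu
  have h1 := (solvesDirichlet_const_mul_iff u u mu).1 hs _ u.pair_mem
  rw [real_inner_self_eq_norm_sq, real_inner_self_eq_norm_sq] at h1
  have h2 := hlow _ u.pair_mem
  have hu0 : 0 < ‖u.pair.1‖ := norm_pos_iff.2 fun h => hu (u.pair_fst_eq_zero_iff.1 h)
  rw [h1] at h2
  exact le_of_mul_le_mul_right h2 (by positivity)

/-- Both equations are tested with e, which trades gradients for factors `lam` and leaves (`lam`² -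
γ)(v, e) = I > 0. The sign of (v, e) is read off from `lam`(v, e) = (u, e) ≥ 0. -/
theorem not_isPositiveSolution (hN : 3 ≤ N)
    (hb : Bornology.IsBounded Ω) {p : ℝ} (hp : 1 < p)
    (hp_crit : p ≤ 2 * (N : ℝ) / ((N : ℝ) - 2) - 1) {lam γ : ℝ} (hlam : 0 < lam) {e : H01 Ω}
    (he0 : 0 ≤ e.pair.1) (he1 : e.pair.1 ≠ 0)
    (he : ∀ z ∈ (testGraph Ω).topologicalClosure,
      inner ℝ e.pair.2 z.2 = lam * inner ℝ e.pair.1 z.1)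
    (hγ : lam ^ 2 ≤ γ) (u : H01 Ω) : ¬ IsPositiveSolution p γ u := by
  rintro ⟨hpos, v, hv, hs⟩
  have henn : ∀ᵐ x ∂(volume.restrict Ω), 0 ≤ e.toFun x := by
    filter_upwards [(Lp.coeFn_nonneg _).2 he0, e.memLp_toFun.coeFn_toLp] with x h1 h2
    simpa only [H01.pair, h2, Pi.zero_apply] using h1
  have hint := u.integrable_rpow_mul hN hb hp hp_crit e
  set I := ∫ x in Ω, |u.toFun x| ^ (p - 1) * u.toFun x * e.toFun x with hI
  have hnn : 0 ≤ᵐ[volume.restrict Ω]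
      fun x => |u.toFun x| ^ (p - 1) * u.toFun x * e.toFun x := by
    filter_upwards [henn, hpos] with x h1 h2
    simp only [Pi.zero_apply]; positivity
  have hIpos : 0 < I := by
    -- If I vanished, so would the integrand almost everywhere, and u > 0 would force e = 0.
    refine (integral_nonneg_of_ae hnn).lt_of_ne fun h => he1 ?_
    rw [e.pair_fst_eq_zero_iff]
    filter_upwards [(integral_eq_zero_iff_of_nonneg_ae hnn hint).1 h.symm, hpos] with x h1 h2
    have h3 : |u.toFun x| ^ (p - 1) * u.toFun x ≠ 0 := by positivity
    simpa [h3] using h1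
  have h1 := hs e
  have hsplit : ∫ x in Ω, (γ * v.toFun x + |u.toFun x| ^ (p - 1) * u.toFun x) * e.toFun x =
      γ * inner ℝ v.pair.1 e.pair.1 + I := by
    rw [← H01.integral_mul, ← integral_const_mul, hI,
      ← integral_add ((v.integrable_mul e).const_mul γ) hint]
    refine integral_congr_ae (.of_forall fun x => ?_)
    simp only
    ring
  rw [hsplit, H01.integral_inner_grad, real_inner_comm, he _ u.pair_mem] at h1
  have h2 := (isInverseLaplacian_iff u v).1 hv _ e.pair_mem
  rw [real_inner_comm, he _ v.pair_mem] at h2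
  have h3 : 0 ≤ inner ℝ u.pair.1 e.pair.1 := by
    rw [← H01.integral_mul]
    refine integral_nonneg_of_ae ?_
    filter_upwards [henn, hpos] with x h1 h2 using mul_nonneg h2.le h1
  rw [real_inner_comm, ← h2] at h1
  rw [← h2, mul_nonneg_iff_of_pos_left hlam] at h3
  rw [real_inner_comm e.pair.1 v.pair.1] at h1
  nlinarith [mul_le_mul_of_nonneg_right hγ h3]

end Eigenvalues

theorem lemma2p1 (N : ℕ) (hN : 3 ≤ N) (Ω : Set (EuclideanSpace ℝ (Fin N)))
    (hΩ_open : IsOpen Ω) (hΩ_conn : IsConnected Ω) (hΩ_bdd : Bornology.IsBounded Ω)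
    (p : ℝ) (hp : 1 < p) (hp_crit : p ≤ 2 * (N : ℝ) / ((N : ℝ) - 2) - 1) :
    ∃ lam₁ lamStar : ℝ,
      IsLeast (laplacianEigenvalues Ω) lam₁ ∧
      IsLeast (nonlocalEigenvalues Ω) lamStar ∧
      lamStar = lam₁ ^ 2 ∧
      ∀ γ : ℝ, lamStar ≤ γ → ¬ ∃ u : H01 Ω, IsPositiveSolution p γ u := by
  obtain ⟨lam, hlam, hlow, w, hw, hw1, hwe⟩ :=
    exists_first_eigenpair (by omega) hΩ_open hΩ_conn.nonempty hΩ_bdd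
  have hwD : w ∈ (testGraph Ω).topologicalClosure := closure_mono nonnegTestGraph_subset hw
  obtain ⟨e, rfl⟩ := exists_H01_pair_eq hwD
  -- Since -Δe = `lam` e, the inverse Laplacian of e is `lam`⁻¹ e, and `lam`² · `lam`⁻¹ = `lam`
  -- makes e a nonlocal eigenfunction.
  obtain ⟨v, hv⟩ := exists_H01_pair_eq ((testGraph Ω).topologicalClosure.smul_mem lam⁻¹ hwD)
  have he0 : e.pair.1 ≠ 0 := fun h => by simp [h] at hw1
  have hne : ¬ e.toFun =ᵐ[volume.restrict Ω] 0 := fun h => he0 (e.pair_fst_eq_zero_iff.2 h)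
  refine ⟨lam, lam ^ 2, ⟨⟨e, hne, (solvesDirichlet_const_mul_iff e e lam).2 hwe⟩,
    fun mu hmu => le_of_mem_laplacianEigenvalues hlow hmu⟩,
    ⟨⟨e, v, hne, (isInverseLaplacian_iff e v).2 ?_, (solvesDirichlet_const_mul_iff e v _).2 ?_⟩,
      fun mu hmu => sq_le_of_mem_nonlocalEigenvalues hlam hlow hmu⟩, rfl, ?_⟩
  · intro z hz
    rw [hv, Prod.smul_snd, real_inner_smul_left, hwe z hz, inv_mul_cancel_left₀ hlam.ne']
  · intro z hz
    rw [hv, Prod.smul_fst, real_inner_smul_left, hwe z hz]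
    field_simp
  · rintro γ hγ ⟨u, hu⟩
    exact not_isPositiveSolution hN hΩ_bdd hp hp_crit hlam
      (nonneg_fst_of_mem_closure hw) he0 hwe hγ u hu
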